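/- Consider $K$ users, a library of $N$ files, and a cache of size $M>0$ files at each user; put $L=\lceil N/M\rceil$. Every file is divided into $F=LF'$ packets, arranged in $F'$ groups of $L$ packets each. *Placement.* For every user, every file and every group, independently, the user stores one packet of that group of that file, chosen uniformly at random. Let $S_{n,f}\subseteq\{1,\dots,K\}$ be the set of users that store packet $f$ of file $n$. *Delivery* (with parameter $g$, for demands $\mathbf d=(d_1,\dots,d_K)\in\{1,\dots,N\}^K$, not necessarily distinct). First (pull-down), for every packet $f$ of every requested file $n$ with $|S_{n,f}|\ge g+1$, independently, replace $S_{n,f}$ by a uniformly random $g$-element subset of itself. Then run the following greedy scheme with the new sets $S_{n,f}$: start with $C=\emptyset$ and go through all pairs $(k,f)$, where $1\le k\le K$ and $f$ is a packet label. If $k\in S_{d_k,f}$ or $(k,f)\in C$, do nothing. Otherwise, for every $j\in S_{d_k,f}$ for which there is a packet label $f'$ with $(j,f')\notin C$ and $S_{d_j,f'}=(S_{d_k,f}\cup\{k\})\setminus\{j\}$, select one such pair $(j,f')$ (the first one, say); let $A$ be the set of the selected pairs, transmit the XOR of packet $f$ of file $d_k$ and of the packets $f'$ of the files $d_j$, $(j,f')\in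 A$, and add $(k,f)$ and the elements of $A$ to $C$. The rate $R(\mathbf d)$ is the number of transmissions divided by $F$. **Theorem.** For every constant $c>0$ there is a function $\varepsilon:\mathbb N\to\mathbb R$ with $\varepsilon(K)\to0$ as $K\to\infty$ such that the following holds for all $K,N,g\in\mathbb N$ and real $M>0$ with $$N>K,\qquad 2\le g\le\frac{K}{3\lceil N/M\rceil},\qquad \lceil N/M\rceil\le\frac{K}{\frac{27}{4}\log K}.$$ For every integer $F'\ge c\binom Kg\bigl(\log\binom Kg\bigr)^2$ and every demand vector $\mathbf d$, $$\mathbb E\,[R(\mathbf d)]\le\frac43\,\frac{K}{g+1}\,\bigl(1+\varepsilon(K)\bigr),$$ where the expectation is over the randomness of both placement and delivery. Moreover, there is such an $F'\geq 1$ for which the number of packets per file satisfies $$F=\lceil N/M\rceil F'\le(c+1)\binom Kg\Bigl(\log\binom Kg\Bigr)^2\lceil N/M\rceil ,$$ so that $F=O\bigl(\binom Kg(\log\binom Kg)^2\lceil N/M\rceil\bigr)$ packets per file suffice. -/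

import Mathlib

open scoped BigOperators

namespace CodedCaching

/-- The number `⌈N/M⌉` of packets in a group, for `N` files and caches of size `M` files. -/
noncomputable def groupSize (N : ℕ) (M : ℝ) : ℕ := ⌈(N : ℝ) / M⌉₊

/-- A cache configuration: for every file `n` and every packet `f` the set `S n f` of users in whose
cache packet `f` of file `n` is stored. `P` is the set of packet labels of a file. -/
abbrev Config (K N : ℕ) (P : Type) := Fin N → P → Finset (Fin K)

/-- Packet labels when a file is divided into `F'` groups of `L` packets: (group, position).
A file has `F = L * F'` packets. -/
abbrev Packet (F' L : ℕ) := Fin F' × Fin L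

/-- All packet labels, in lexicographic order. -/
def packetList (F' L : ℕ) : List (Packet F' L) := List.finRange F' ×ˢ List.finRange L

/-- An outcome of the random placement: `ω k n f'` is the position of the packet of group `f'` of
file `n` that user `k` caches. All the choices are independent and uniform, so the random placement
is a uniformly random element of this finite type. -/
abbrev Placement (K N F' L : ℕ) := Fin K → Fin N → Fin F' → Fin L

/-- The cache configuration that results from a placement. -/
def Placement.config {K N F' L : ℕ} (ω : Placement K N F' L) : Config K N (Packet F' L) :=
  fun n p => Finset.univ.filter fun k => ω k n p.1 = p.2

section Delivery

variable {K N : ℕ} {P : Type} [DecidableEq P]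

/-- A node `(k, f)` stands for the packet `f` of the file `d k` requested by user `k`.
`partners packets S d C (k, f)` is the set `A` built in one iteration of the delivery: for every
user `j ∈ S (d k) f` it holds the first node `(j, f')` (if there is one) that is not yet covered
(not in `C`) and has `S (d j) f' = S (d k) f ∪ {k} - {j}`. -/
def partners (packets : List P) (S : Config K N P) (d : Fin K → Fin N)
    (C : Finset (Fin K × P)) (v : Fin K × P) : Finset (Fin K × P) :=
  (S (d v.1) v.2).biUnion fun j =>
    ((packets.find? fun f' =>
      decide ((j, f') ∉ C ∧ S (d j) f' = (insert v.1 (S (d v.1) v.2)).erase j)).map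
        fun f' => (j, f')).toFinset

/-- One iteration of the delivery. The state consists of the set `C` of covered nodes and the list of
transmissions made so far; a transmission is the XOR of the packets of a set of nodes. Nothing is
done if user `k` holds the packet or if the node is already covered. -/
def deliveryStep (packets : List P) (S : Config K N P) (d : Fin K → Fin N)
    (st : Finset (Fin K × P) × List (Finset (Fin K × P))) (v : Fin K × P) :
    Finset (Fin K × P) × List (Finset (Fin K × P)) :=
  if v.1 ∈ S (d v.1) v.2 ∨ v ∈ st.1 then st
  else
    (insert v (st.1 ∪ partners packets S d st.1 v),
      insert v (partners packets S d st.1 v) :: st.2)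

/-- The list of all transmissions made by the greedy clique cover delivery (NewDelivery) for the
configuration `S` and the demands `d`, running through all nodes `(k, f)` in lexicographic order. -/
def newDelivery (packets : List P) (S : Config K N P) (d : Fin K → Fin N) :
    List (Finset (Fin K × P)) :=
  ((List.finRange K ×ˢ packets).foldl (deliveryStep packets S d) (∅, [])).2

/-- The normalized number of transmissions of NewDelivery: the number of transmitted packets divided
by the number of packets of a file. -/
noncomputable def rateND (packets : List P) (S : Config K N P) (d : Fin K → Fin N) : ℝ :=
  ((newDelivery packets S d).length : ℝ) / (packets.length : ℝ)

/-- The possible results of the pull-down phase with parameter `g`: for every packet of a requested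
file that is stored in at least `g + 1` caches, `S n f` is replaced by one of its `g`-subsets;
all other `S n f` are kept. Since this is a product set, an independent and uniform choice of a
`g`-subset for every such packet is the same as a uniform choice from this set. -/
def pullDowns [Fintype P] (g : ℕ) (S : Config K N P) (d : Fin K → Fin N) :
    Finset (Config K N P) :=
  Fintype.piFinset fun n => Fintype.piFinset fun f =>
    if (∃ k, d k = n) ∧ g + 1 ≤ (S n f).card then (S n f).powersetCard g else {S n f}

/-- The expected rate of ModifiedDelivery (a random pull-down followed by NewDelivery on the resulting
virtual configuration), for a fixed cache configuration `S` and demands `d`. -/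
noncomputable def expectedRateMD [Fintype P] (packets : List P) (g : ℕ) (S : Config K N P)
    (d : Fin K → Fin N) : ℝ :=
  Finset.expect (pullDowns g S d) fun S' => rateND packets S' d

end Delivery

/-- The expected rate, over the random placement and the random pull-down, for files that consist of
`F'` groups of `L` packets. -/
noncomputable def expectedRate {K N : ℕ} (F' L g : ℕ) (d : Fin K → Fin N) : ℝ :=
  Finset.expect (Finset.univ : Finset (Placement K N F' L)) fun ω =>
    expectedRateMD (packetList F' L) g ω.config d

end CodedCaching

/-!
Call two nodes equivalent if their classes `{k} ∪ S (d k) f` agree. A greedy transmission for a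
node of class `U` serves one uncovered node of each user in `U` that still has one, so it lowers
`∑ U, max_{j ∈ U} (number of uncovered nodes of user j in class U)`; hence the initial value of this
potential bounds the number of transmissions. After the pull-down a class has at most `g + 1` users.
For `|U| = g + 1` each of the counts is a sum of independent contributions of the groups, every one
of which is at most `1`, so by symmetry its mean and its variance are at most
`m = F' L / (K choose g)`. The expected maximum of `g + 1` such counts is at most
`m + √((g + 1) m) = m (1 + o(1))`, and summing over `U` gives `F * K / (g + 1) * (1 + o(1))`. The
smaller classes come from packets stored by fewer than `g` users, which are exponentially rare by
Markov's inequality for `2 ^ (-#S)`.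
-/

namespace CodedCaching

open Finset

section StoredCount

variable {K N : ℕ} {P : Type} [Fintype P]

/-- The number of packets of file `n` that are stored by exactly the users in `W`. -/
def storedCount (S : Config K N P) (n : Fin N) (W : Finset (Fin K)) : ℕ :=
  #{f | S n f = W}

lemma sum_storedCount_erase_le {S : Config K N P} {n : Fin N} {g : ℕ} (hS : ∀ f, #(S n f) ≤ g)
    (j : Fin K) :
    ∑ U : Finset (Fin K) with #U ≠ g + 1 ∧ j ∈ U, storedCount S n (U.erase j)
      ≤ #{f | #(S n f) < g} := by
  have hinj : Set.InjOn (fun U : Finset (Fin K) => U.erase j)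
      ({U : Finset (Fin K) | #U ≠ g + 1 ∧ j ∈ U} : Finset (Finset (Fin K))) :=
    (erase_injOn' j).mono fun U hU => (mem_filter.1 hU).2.2
  rw [← sum_image (f := storedCount S n) hinj]
  simp only [storedCount]
  rw [sum_card_fiberwise_eq_card_filter]
  refine card_le_card (monotone_filter_right _ fun f _ hf => ?_)
  obtain ⟨U, hU, hUf⟩ := mem_image.1 hf
  obtain ⟨hUg, hjU⟩ := (mem_filter.1 hU).2
  have hcard := card_erase_add_one hjU
  have hSf := hS f
  rw [← hUf] at hSf ⊢
  omega

end StoredCount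

section Greedy

variable {K N : ℕ} {P : Type} [DecidableEq P] [Fintype P]

/-- The class of a node `(k, f)`: the user `k` together with the users that store packet `f` of the
file requested by `k`. Nodes of one class with distinct users can be served by one transmission. -/
def nodeClass (S : Config K N P) (d : Fin K → Fin N) (v : Fin K × P) : Finset (Fin K) :=
  insert v.1 (S (d v.1) v.2)

/-- The packets `f` for which the node `(j, f)` is not in `C` and has class `U`. For `j ∈ U` the
latter is encoded, as in `partners`, by `S (d j) f = U.erase j`. -/
def uncovered (S : Config K N P) (d : Fin K → Fin N) (C : Finset (Fin K × P))
    (U : Finset (Fin K)) (j : Fin K) : Finset P :=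
  {f | (j, f) ∉ C ∧ S (d j) f = U.erase j}

/-- The potential of the greedy delivery: the sum over all classes of the largest number of
uncovered nodes that a user has in the class. -/
def potential (S : Config K N P) (d : Fin K → Fin N) (C : Finset (Fin K × P)) : ℕ :=
  ∑ U : Finset (Fin K), U.sup fun j => #(uncovered S d C U j)

lemma mem_uncovered {S : Config K N P} {d : Fin K → Fin N} {C : Finset (Fin K × P)}
    {U : Finset (Fin K)} {j : Fin K} {f : P} :
    f ∈ uncovered S d C U j ↔ (j, f) ∉ C ∧ S (d j) f = U.erase j := by
  simp [uncovered]

lemma uncovered_anti (S : Config K N P) (d : Fin K → Fin N) {C C' : Finset (Fin K × P)}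
    (h : C ⊆ C') (U : Finset (Fin K)) (j : Fin K) : uncovered S d C' U j ⊆ uncovered S d C U j :=
  monotone_filter_right _ fun _ _ hf => ⟨fun hC => hf.1 (h hC), hf.2⟩

lemma mem_uncovered_nodeClass {S : Config K N P} {d : Fin K → Fin N} {C : Finset (Fin K × P)}
    {v : Fin K × P} (hv : v.1 ∉ S (d v.1) v.2) (hC : v ∉ C) :
    v.2 ∈ uncovered S d C (nodeClass S d v) v.1 :=
  mem_uncovered.2 ⟨hC, (erase_insert hv).symm⟩

lemma exists_mem_uncovered_mem_partners {packets : List P} (hp : ∀ f, f ∈ packets)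
    {S : Config K N P} {d : Fin K → Fin N} {C : Finset (Fin K × P)} {v : Fin K × P} {j : Fin K}
    (hj : j ∈ S (d v.1) v.2) (hne : (uncovered S d C (nodeClass S d v) j).Nonempty) :
    ∃ f ∈ uncovered S d C (nodeClass S d v) j, (j, f) ∈ partners packets S d C v := by
  obtain ⟨f₀, hf₀⟩ := hne
  cases hfind : packets.find? fun f' =>
      decide ((j, f') ∉ C ∧ S (d j) f' = (insert v.1 (S (d v.1) v.2)).erase j) with
  | none =>
    exact absurd (decide_eq_true (mem_uncovered.1 hf₀)) (List.find?_eq_none.1 hfind f₀ (hp f₀))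
  | some f =>
    have hf := List.find?_some hfind
    exact ⟨f, mem_uncovered.2 (of_decide_eq_true hf), mem_biUnion.2 ⟨j, hj, by rw [hfind]; simp⟩⟩

lemma card_uncovered_step_lt {packets : List P} (hp : ∀ f, f ∈ packets) {S : Config K N P}
    {d : Fin K → Fin N} {C : Finset (Fin K × P)} {v : Fin K × P} (hv : v.1 ∉ S (d v.1) v.2)
    (hC : v ∉ C) {j : Fin K} (hj : j ∈ nodeClass S d v)
    (hne : (uncovered S d C (nodeClass S d v) j).Nonempty) :
    #(uncovered S d (insert v (C ∪ partners packets S d C v)) (nodeClass S d v) j)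
      < #(uncovered S d C (nodeClass S d v) j) := by
  obtain ⟨f, hf, hfC⟩ : ∃ f ∈ uncovered S d C (nodeClass S d v) j,
      (j, f) ∈ insert v (C ∪ partners packets S d C v) := by
    rcases mem_insert.1 hj with rfl | hjS
    · exact ⟨v.2, mem_uncovered_nodeClass hv hC, mem_insert_self _ _⟩
    · obtain ⟨f, hf, hfp⟩ := exists_mem_uncovered_mem_partners hp hjS hne
      exact ⟨f, hf, mem_insert_of_mem (mem_union_right _ hfp)⟩
  have hsub := uncovered_anti S d (subset_union_left.trans (subset_insert v _))
    (C' := insert v (C ∪ partners packets S d C v)) (nodeClass S d v) j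
  exact card_lt_card ((ssubset_iff_of_subset hsub).2
    ⟨f, hf, fun hf' => (mem_uncovered.1 hf').1 hfC⟩)

lemma potential_step_lt {packets : List P} (hp : ∀ f, f ∈ packets) {S : Config K N P}
    {d : Fin K → Fin N} {C : Finset (Fin K × P)} {v : Fin K × P} (hv : v.1 ∉ S (d v.1) v.2)
    (hC : v ∉ C) :
    potential S d (insert v (C ∪ partners packets S d C v)) < potential S d C := by
  have hanti (U : Finset (Fin K)) (j : Fin K) :
      #(uncovered S d (insert v (C ∪ partners packets S d C v)) U j) ≤ #(uncovered S d C U j) :=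
    card_le_card (uncovered_anti S d (subset_union_left.trans (subset_insert _ _)) U j)
  have hle {j : Fin K} (hj : j ∈ nodeClass S d v) :
      #(uncovered S d C (nodeClass S d v) j)
        ≤ (nodeClass S d v).sup fun j => #(uncovered S d C (nodeClass S d v) j) :=
    le_sup (f := fun j => #(uncovered S d C (nodeClass S d v) j)) hj
  have hpos : 0 < (nodeClass S d v).sup fun j => #(uncovered S d C (nodeClass S d v) j) :=
    (card_pos.2 ⟨v.2, mem_uncovered_nodeClass hv hC⟩).trans_le (hle (mem_insert_self _ _))
  refine sum_lt_sum (fun U _ => sup_mono_fun fun j _ => hanti U j)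
    ⟨nodeClass S d v, mem_univ _, (Finset.sup_lt_iff hpos).2 fun j hj => ?_⟩
  rcases (uncovered S d C (nodeClass S d v) j).eq_empty_or_nonempty with hempty | hne
  · exact ((hanti _ j).trans_eq (card_eq_zero.2 hempty)).trans_lt hpos
  · exact (card_uncovered_step_lt hp hv hC hj hne).trans_le (hle hj)

lemma length_foldl_deliveryStep_le {packets : List P} (hp : ∀ f, f ∈ packets) (S : Config K N P)
    (d : Fin K → Fin N) (l : List (Fin K × P))
    (st : Finset (Fin K × P) × List (Finset (Fin K × P))) :
    (l.foldl (deliveryStep packets S d) st).2.length ≤ st.2.length + potential S d st.1 := by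
  induction l generalizing st with
  | nil => exact Nat.le_add_right _ _
  | cons v l ih =>
    refine (ih _).trans ?_
    unfold deliveryStep
    split_ifs with h
    · exact le_rfl
    · have hlt := potential_step_lt hp (not_or.1 h).1 (not_or.1 h).2
      simp only [List.length_cons]
      omega

lemma length_newDelivery_le_sum_sup {packets : List P} (hp : ∀ f, f ∈ packets) (S : Config K N P)
    (d : Fin K → Fin N) :
    (newDelivery packets S d).length
      ≤ ∑ U : Finset (Fin K), U.sup fun j => storedCount S (d j) (U.erase j) := by
  refine (length_foldl_deliveryStep_le hp S d _ _).trans_eq ?_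
  simp [potential, uncovered, storedCount]

lemma length_newDelivery_le {packets : List P} (hp : ∀ f, f ∈ packets) {S : Config K N P}
    {d : Fin K → Fin N} {g : ℕ} (hS : ∀ k f, #(S (d k) f) ≤ g) :
    (newDelivery packets S d).length
      ≤ (∑ U ∈ univ.powersetCard (g + 1), U.sup fun j => storedCount S (d j) (U.erase j))
        + ∑ j, #{f | #(S (d j) f) < g} := by
  refine (length_newDelivery_le_sum_sup hp S d).trans ?_
  rw [← sum_filter_add_sum_filter_not univ (fun U : Finset (Fin K) => #U = g + 1),
    powersetCard_eq_filter, powerset_univ]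
  gcongr
  calc ∑ U with ¬ #U = g + 1, U.sup (fun j => storedCount S (d j) (U.erase j))
      ≤ ∑ U : Finset (Fin K) with ¬ #U = g + 1, ∑ j ∈ U, storedCount S (d j) (U.erase j) := by
        gcongr with U
        exact Finset.sup_le fun j hj =>
          single_le_sum (f := fun j => storedCount S (d j) (U.erase j)) (fun _ _ => zero_le) hj
    _ = ∑ j, ∑ U : Finset (Fin K) with #U ≠ g + 1 ∧ j ∈ U, storedCount S (d j) (U.erase j) :=
        sum_comm' (by simp)
    _ ≤ ∑ j, #{f | #(S (d j) f) < g} := by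
        gcongr with j
        exact sum_storedCount_erase_le (hS j) j

end Greedy

section ProductExpectation

variable {ι : Type*} [Fintype ι] [DecidableEq ι]

lemma expect_piFinset_prod {κ : ι → Type*} {t : ∀ i, Finset (κ i)} (ht : ∀ i, (t i).Nonempty)
    (s : Finset ι) (f : ∀ i, κ i → ℝ) :
    𝔼 x ∈ Fintype.piFinset t, ∏ i ∈ s, f i (x i) = ∏ i ∈ s, 𝔼 y ∈ t i, f i y := by
  have huniv (h : ∀ i, κ i → ℝ) :
      𝔼 x ∈ Fintype.piFinset t, ∏ i, h i (x i) = ∏ i, 𝔼 y ∈ t i, h i y := by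
    simp only [expect_eq_sum_div_card, Fintype.card_piFinset, prod_div_distrib, prod_univ_sum,
      Nat.cast_prod]
  rw [← Fintype.prod_ite_mem s fun i => 𝔼 y ∈ t i, f i y]
  simp_rw [← Fintype.prod_ite_mem s fun i => f i _]
  rw [huniv fun i y => if i ∈ s then f i y else 1]
  refine prod_congr rfl fun i _ => ?_
  split_ifs
  · rfl
  · exact expect_const (ht i) 1

variable {κ : Type*} {t : ι → Finset κ}

lemma expect_piFinset_apply (ht : ∀ i, (t i).Nonempty) (i : ι) (f : κ → ℝ) :
    𝔼 x ∈ Fintype.piFinset t, f (x i) = 𝔼 y ∈ t i, f y := by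
  simpa using expect_piFinset_prod ht {i} fun _ => f

lemma expect_piFinset_apply_mul_apply (ht : ∀ i, (t i).Nonempty) {i j : ι} (hij : i ≠ j)
    (f h : κ → ℝ) :
    𝔼 x ∈ Fintype.piFinset t, f (x i) * h (x j) = (𝔼 y ∈ t i, f y) * 𝔼 y ∈ t j, h y := by
  simpa [prod_pair hij, hij.symm] using
    expect_piFinset_prod ht {i, j} fun l => if l = i then f else h

end ProductExpectation

section TwoStageExpectation

variable {Ω α : Type*} [Fintype Ω]

/-- The expectation of `φ` at the outcome of a two-stage experiment, which picks a uniform point `a`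
of `Ω` and then a uniform element of `t a`. -/
noncomputable def twoStageExpect (t : Ω → Finset α) (φ : α → ℝ) : ℝ := 𝔼 a, 𝔼 x ∈ t a, φ x

lemma twoStageExpect_mono {t : Ω → Finset α} {φ ψ : α → ℝ} (h : ∀ a, ∀ x ∈ t a, φ x ≤ ψ x) :
    twoStageExpect t φ ≤ twoStageExpect t ψ :=
  expect_le_expect fun a _ => expect_le_expect (h a)

lemma twoStageExpect_add (t : Ω → Finset α) (φ ψ : α → ℝ) :
    twoStageExpect t (fun x => φ x + ψ x) = twoStageExpect t φ + twoStageExpect t ψ := by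
  simp only [twoStageExpect, expect_add_distrib]

lemma twoStageExpect_const_mul (t : Ω → Finset α) (b : ℝ) (φ : α → ℝ) :
    twoStageExpect t (fun x => b * φ x) = b * twoStageExpect t φ := by
  simp only [twoStageExpect, mul_expect]

lemma twoStageExpect_sum {ι : Type*} (t : Ω → Finset α) (s : Finset ι) (φ : ι → α → ℝ) :
    twoStageExpect t (fun x => ∑ i ∈ s, φ i x) = ∑ i ∈ s, twoStageExpect t (φ i) := by
  simp only [twoStageExpect, expect_sum_comm]

variable [Nonempty Ω] {t : Ω → Finset α}

lemma twoStageExpect_const (ht : ∀ a, (t a).Nonempty) (b : ℝ) :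
    twoStageExpect t (fun _ => b) = b := by
  simp only [twoStageExpect, expect_const (ht _), Fintype.expect_const]

lemma twoStageExpect_sqrt_le (ht : ∀ a, (t a).Nonempty) {φ : α → ℝ} (hφ : ∀ x, 0 ≤ φ x) :
    twoStageExpect t (fun x => √(φ x)) ≤ √(twoStageExpect t φ) := by
  set e := twoStageExpect t fun x => √(φ x) with he
  have hvar : 0 ≤ twoStageExpect t fun x => (√(φ x) - e) ^ 2 :=
    expect_nonneg fun a _ => expect_nonneg fun x _ => sq_nonneg _
  have hexpand (x : α) : (√(φ x) - e) ^ 2 = φ x + (-2 * e * √(φ x) + e ^ 2) := by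
    rw [sub_sq, Real.sq_sqrt (hφ x)]
    ring
  simp only [hexpand, twoStageExpect_add, twoStageExpect_const_mul, twoStageExpect_const ht,
    ← he] at hvar
  exact Real.le_sqrt_of_sq_le (by linarith)

lemma twoStageExpect_sum_sub_sq_le (ht : ∀ a, (t a).Nonempty) {ι : Type*} [Fintype ι]
    {X : ι → α → ℝ} {p : ℝ} (hmean : ∀ i, twoStageExpect t (X i) = p)
    (hmul : ∀ i j, i ≠ j → twoStageExpect t (fun x => X i x * X j x) = p * p)
    (hsq : ∀ i, twoStageExpect t (fun x => X i x * X i x) ≤ p) :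
    twoStageExpect t (fun x => (∑ i, X i x - Fintype.card ι * p) ^ 2) ≤ Fintype.card ι * p := by
  classical
  have hexpand (x : α) : (∑ i, X i x - Fintype.card ι * p) ^ 2 = ∑ i, ∑ j, X i x * X j x
      + (-2 * (Fintype.card ι * p) * ∑ i, X i x + (Fintype.card ι * p) ^ 2) := by
    rw [← sum_mul_sum]
    ring
  have hcov (i j : ι) :
      twoStageExpect t (fun x => X i x * X j x) ≤ p * p + if i = j then p else 0 := by
    split_ifs with hij
    · subst hij
      linarith [hsq i, mul_self_nonneg p]
    · rw [hmul i j hij, add_zero]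
  have hsum : ∑ i, ∑ j, twoStageExpect t (fun x => X i x * X j x)
      ≤ (Fintype.card ι * p) ^ 2 + Fintype.card ι * p := by
    refine (sum_le_sum fun i _ => sum_le_sum fun j _ => hcov i j).trans_eq ?_
    simp only [sum_add_distrib, sum_const, card_univ, nsmul_eq_mul, sum_ite_eq, mem_univ, if_true]
    ring
  simp only [hexpand, twoStageExpect_add, twoStageExpect_const_mul, twoStageExpect_const ht,
    twoStageExpect_sum, hmean, sum_const, card_univ, nsmul_eq_mul]
  linarith

lemma cast_sup_le_add_sqrt {ι : Type*} {U : Finset ι} (hU : U.Nonempty) (n : ι → ℕ) {μ : ι → ℝ}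
    {m : ℝ} (hμ : ∀ j ∈ U, μ j ≤ m) :
    ((U.sup n : ℕ) : ℝ) ≤ m + √(∑ j ∈ U, ((n j : ℝ) - μ j) ^ 2) := by
  obtain ⟨j, hj, hsup⟩ := exists_mem_eq_sup U hU n
  have hdev : (n j : ℝ) - μ j ≤ √(∑ j ∈ U, ((n j : ℝ) - μ j) ^ 2) :=
    Real.le_sqrt_of_sq_le
      (single_le_sum (f := fun j => ((n j : ℝ) - μ j) ^ 2) (fun _ _ => sq_nonneg _) hj)
  rw [hsup]
  linarith [hμ j hj]

lemma twoStageExpect_sup_le (ht : ∀ a, (t a).Nonempty) {ι : Type*} {U : Finset ι}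
    (hU : U.Nonempty) (n : ι → α → ℕ) {μ : ι → ℝ} {m v : ℝ} (hμ : ∀ j ∈ U, μ j ≤ m)
    (hv : ∀ j ∈ U, twoStageExpect t (fun x => ((n j x : ℝ) - μ j) ^ 2) ≤ v) :
    twoStageExpect t (fun x => ((U.sup fun j => n j x : ℕ) : ℝ)) ≤ m + √(#U * v) :=
  calc twoStageExpect t (fun x => ((U.sup fun j => n j x : ℕ) : ℝ))
      ≤ twoStageExpect t (fun x => m + √(∑ j ∈ U, ((n j x : ℝ) - μ j) ^ 2)) :=
        twoStageExpect_mono fun _ x _ => cast_sup_le_add_sqrt hU (fun j => n j x) hμ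
    _ ≤ m + √(∑ j ∈ U, twoStageExpect t fun x => ((n j x : ℝ) - μ j) ^ 2) := by
        rw [twoStageExpect_add, twoStageExpect_const ht, ← twoStageExpect_sum]
        gcongr
        exact twoStageExpect_sqrt_le ht fun x => sum_nonneg fun j _ => sq_nonneg _
    _ ≤ m + √(#U * v) := by
        gcongr
        exact (sum_le_card_nsmul U _ v hv).trans_eq (nsmul_eq_mul _ _)

end TwoStageExpectation

section PullDown

variable {α : Type*}

/-- The possible results of the pull-down with parameter `g` of one packet that is stored by the
users in `A`. -/
def pullDown (g : ℕ) (A : Finset α) : Finset (Finset α) :=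
  if g + 1 ≤ #A then A.powersetCard g else {A}

variable {g : ℕ} {A B : Finset α}

lemma pullDown_nonempty (g : ℕ) (A : Finset α) : (pullDown g A).Nonempty := by
  unfold pullDown
  split_ifs with hA
  · exact powersetCard_nonempty.2 (Nat.le_of_succ_le hA)
  · exact singleton_nonempty A

lemma subset_of_mem_pullDown (hB : B ∈ pullDown g A) : B ⊆ A := by
  unfold pullDown at hB
  split_ifs at hB
  · exact (mem_powersetCard.1 hB).1
  · exact (mem_singleton.1 hB).subset

lemma card_le_of_mem_pullDown (hB : B ∈ pullDown g A) : #B ≤ g := by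
  unfold pullDown at hB
  split_ifs at hB with hA
  · exact (mem_powersetCard.1 hB).2.le
  · rw [mem_singleton.1 hB]
    omega

lemma card_lt_of_mem_pullDown (hB : B ∈ pullDown g A) (hg : #B < g) : #A < g := by
  unfold pullDown at hB
  split_ifs at hB
  · exact absurd (mem_powersetCard.1 hB).2 hg.ne
  · rwa [← mem_singleton.1 hB]

lemma pullDown_map {β : Type*} (g : ℕ) (e : α ↪ β) (A : Finset α) :
    pullDown g (A.map e) = (pullDown g A).map (mapEmbedding e).toEmbedding := by
  unfold pullDown
  rw [card_map]
  split_ifs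
  · exact powersetCard_map _ _ _
  · rfl

end PullDown

section PullDowns

variable {K N : ℕ} {P : Type}

lemma pullDowns_factor_nonempty (g : ℕ) (S : Config K N P) (d : Fin K → Fin N) (n : Fin N)
    (f : P) : (if ∃ k, d k = n then pullDown g (S n f) else {S n f}).Nonempty := by
  split_ifs
  · exact pullDown_nonempty g _
  · exact singleton_nonempty _

variable [DecidableEq P] [Fintype P]

lemma pullDowns_eq_piFinset (g : ℕ) (S : Config K N P) (d : Fin K → Fin N) :
    pullDowns g S d = Fintype.piFinset fun n => Fintype.piFinset fun f =>
      if ∃ k, d k = n then pullDown g (S n f) else {S n f} := by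
  simp only [pullDowns, pullDown, ite_and]

lemma pullDowns_nonempty (g : ℕ) (S : Config K N P) (d : Fin K → Fin N) :
    (pullDowns g S d).Nonempty := by
  rw [pullDowns_eq_piFinset]
  exact Fintype.piFinset_nonempty.2 fun n =>
    Fintype.piFinset_nonempty.2 (pullDowns_factor_nonempty g S d n)

lemma mem_pullDown_of_mem_pullDowns {g : ℕ} {S S' : Config K N P} {d : Fin K → Fin N}
    (hS' : S' ∈ pullDowns g S d) (k : Fin K) (f : P) : S' (d k) f ∈ pullDown g (S (d k) f) := by
  rw [pullDowns_eq_piFinset] at hS'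
  simpa using Fintype.mem_piFinset.1 (Fintype.mem_piFinset.1 hS' (d k)) f

lemma expect_pullDowns_file (g : ℕ) (S : Config K N P) (d : Fin K → Fin N) (k : Fin K)
    (h : (P → Finset (Fin K)) → ℝ) :
    𝔼 S' ∈ pullDowns g S d, h (S' (d k))
      = 𝔼 y ∈ Fintype.piFinset fun f => pullDown g (S (d k) f), h y := by
  rw [pullDowns_eq_piFinset, expect_piFinset_apply (fun n =>
    Fintype.piFinset_nonempty.2 (pullDowns_factor_nonempty g S d n)) (d k) h]
  simp only [exists_apply_eq_apply, if_true]

lemma expect_pullDowns_apply (g : ℕ) (S : Config K N P) (d : Fin K → Fin N) (k : Fin K) (f : P)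
    (h : Finset (Fin K) → ℝ) :
    𝔼 S' ∈ pullDowns g S d, h (S' (d k) f) = 𝔼 A ∈ pullDown g (S (d k) f), h A := by
  rw [expect_pullDowns_file g S d k fun y => h (y f)]
  exact expect_piFinset_apply (fun _ => pullDown_nonempty g _) f h

lemma expect_pullDowns_apply_mul_apply (g : ℕ) (S : Config K N P) (d : Fin K → Fin N) (k : Fin K)
    {f f' : P} (hf : f ≠ f') (h h' : Finset (Fin K) → ℝ) :
    𝔼 S' ∈ pullDowns g S d, h (S' (d k) f) * h' (S' (d k) f')
      = (𝔼 A ∈ pullDown g (S (d k) f), h A) * 𝔼 A ∈ pullDown g (S (d k) f'), h' A := by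
  rw [expect_pullDowns_file g S d k fun y => h (y f) * h' (y f')]
  exact expect_piFinset_apply_mul_apply (fun _ => pullDown_nonempty g _) hf h h'

end PullDowns

section VirtualConfig

variable {K N F' L : ℕ}

/-- The users that choose position `l` in a group in which user `k` chooses `w k`. -/
def holders (w : Fin K → Fin L) (l : Fin L) : Finset (Fin K) := {k | w k = l}

/-- The possible user sets of the packet in position `l` of a group after the pull-down, given the
positions `w` chosen by the users in that group. -/
def pulledHolders (g : ℕ) (l : Fin L) (w : Fin K → Fin L) : Finset (Finset (Fin K)) :=
  pullDown g (holders w l)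

/-- The possible virtual configurations, on which the delivery acts, for a given placement. -/
def virtualConfigs (g : ℕ) (d : Fin K → Fin N) (ω : Placement K N F' L) :
    Finset (Config K N (Packet F' L)) :=
  pullDowns g ω.config d

lemma virtualConfigs_nonempty (g : ℕ) (d : Fin K → Fin N) (ω : Placement K N F' L) :
    (virtualConfigs g d ω).Nonempty :=
  pullDowns_nonempty g _ d

/-- A placement read as one independent choice, of the positions taken by all users, for every
group of every file. -/
def placementEquiv (K N F' L : ℕ) : Placement K N F' L ≃ (Fin N × Fin F' → Fin K → Fin L) where
  toFun ω x k := ω k x.1 x.2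
  invFun w k n i := w (n, i) k
  left_inv _ := rfl
  right_inv _ := rfl

lemma expect_placement (φ : (Fin N × Fin F' → Fin K → Fin L) → ℝ) :
    𝔼 ω : Placement K N F' L, φ (placementEquiv K N F' L ω)
      = 𝔼 w ∈ Fintype.piFinset fun _ => univ, φ w := by
  rw [Fintype.piFinset_univ]
  exact Fintype.expect_equiv (placementEquiv K N F' L) _ _ fun _ => rfl

variable [NeZero L]

lemma twoStageExpect_virtualConfigs_apply (g : ℕ) (d : Fin K → Fin N) (k : Fin K) (i : Fin F')
    (l : Fin L) (h : Finset (Fin K) → ℝ) :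
    twoStageExpect (virtualConfigs g d) (fun S => h (S (d k) (i, l)))
      = twoStageExpect (pulledHolders g l) h := by
  simp only [twoStageExpect, virtualConfigs, expect_pullDowns_apply]
  refine (expect_placement fun w => 𝔼 A ∈ pulledHolders g l (w (d k, i)), h A).trans ?_
  exact expect_piFinset_apply (fun _ => univ_nonempty) (d k, i) fun w =>
    𝔼 A ∈ pulledHolders g l w, h A

lemma twoStageExpect_virtualConfigs_apply_mul_apply (g : ℕ) (d : Fin K → Fin N) (k : Fin K)
    {i i' : Fin F'} (hi : i ≠ i') (l l' : Fin L) (h h' : Finset (Fin K) → ℝ) :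
    twoStageExpect (virtualConfigs g d) (fun S => h (S (d k) (i, l)) * h' (S (d k) (i', l')))
      = twoStageExpect (pulledHolders g l) h * twoStageExpect (pulledHolders g l') h' := by
  have hne : (i, l) ≠ (i', l') := fun e => hi (congrArg Prod.fst e)
  simp only [twoStageExpect, virtualConfigs, expect_pullDowns_apply_mul_apply g _ d k hne]
  refine (expect_placement fun w => (𝔼 A ∈ pulledHolders g l (w (d k, i)), h A)
    * 𝔼 A ∈ pulledHolders g l' (w (d k, i')), h' A).trans ?_
  exact expect_piFinset_apply_mul_apply (fun _ => univ_nonempty)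
    (fun e => hi (congrArg Prod.snd e)) (fun w => 𝔼 A ∈ pulledHolders g l w, h A)
    fun w => 𝔼 A ∈ pulledHolders g l' w, h' A

end VirtualConfig

section SinglePacket

variable {K L : ℕ}

lemma pulledHolders_nonempty (g : ℕ) (l : Fin L) (w : Fin K → Fin L) :
    (pulledHolders g l w).Nonempty :=
  pullDown_nonempty g _

/-- The probability that, after the pull-down, a packet is stored by exactly the users in `W`. -/
noncomputable def hitProb (g : ℕ) (l : Fin L) (W : Finset (Fin K)) : ℝ :=
  twoStageExpect (pulledHolders g l) fun A => if A = W then 1 else 0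

lemma holders_comp_symm (σ : Equiv.Perm (Fin K)) (w : Fin K → Fin L) (l : Fin L) :
    holders (w ∘ σ.symm) l = (holders w l).map σ.toEmbedding := by
  ext k
  simp [holders, mem_map_equiv]

lemma hitProb_map (g : ℕ) (l : Fin L) (σ : Equiv.Perm (Fin K)) (W : Finset (Fin K)) :
    hitProb g l (W.map σ.toEmbedding) = hitProb g l W := by
  symm
  refine Fintype.expect_equiv (σ.arrowCongr (Equiv.refl _)) _ _ fun w => ?_
  have hpull : pulledHolders g l (σ.arrowCongr (Equiv.refl _) w)
      = (pulledHolders g l w).map (mapEmbedding σ.toEmbedding).toEmbedding :=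
    (congrArg (pullDown g) (holders_comp_symm σ w l)).trans (pullDown_map g _ _)
  rw [hpull, expect_eq_sum_div_card, expect_eq_sum_div_card, sum_map, card_map]
  simp [map_inj]

lemma hitProb_eq_of_card_eq (g : ℕ) (l : Fin L) {W W' : Finset (Fin K)} (h : #W = #W') :
    hitProb g l W = hitProb g l W' := by
  obtain ⟨σ, rfl⟩ := Equiv.Perm.exists_map_finset_eq _ _ h
  exact (hitProb_map g l σ W).symm

lemma sum_hitProb_le_one [NeZero L] (g : ℕ) (l : Fin L) (s : Finset (Finset (Fin K))) :
    ∑ W ∈ s, hitProb g l W ≤ 1 := by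
  simp only [hitProb]
  rw [← twoStageExpect_sum]
  refine (twoStageExpect_mono fun _ A _ => ?_).trans_eq
    (twoStageExpect_const (pulledHolders_nonempty g l) 1)
  rw [sum_ite_eq]
  split_ifs <;> norm_num

lemma hitProb_le [NeZero L] {g : ℕ} (l : Fin L) {W : Finset (Fin K)} (hW : #W = g) :
    hitProb g l W ≤ 1 / K.choose g := by
  have hgK : g ≤ K := hW ▸ (card_le_univ W).trans_eq (Fintype.card_fin K)
  rw [le_div_iff₀' (Nat.cast_pos.2 (Nat.choose_pos hgK))]
  calc K.choose g * hitProb g l W = ∑ W' ∈ univ.powersetCard g, hitProb g l W' := by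
        rw [sum_congr rfl fun W' hW' =>
          hitProb_eq_of_card_eq g l ((mem_powersetCard.1 hW').2.trans hW.symm)]
        simp
    _ ≤ 1 := sum_hitProb_le_one g l _

lemma expect_half_pow_card_holders [NeZero L] (l : Fin L) :
    𝔼 w : Fin K → Fin L, (1 / 2 : ℝ) ^ #(holders w l) = (1 - 1 / (2 * L)) ^ K := by
  have hL : (L : ℝ) ≠ 0 := Nat.cast_ne_zero.2 (NeZero.ne L)
  have hone : 𝔼 a : Fin L, (if a = l then (1 / 2 : ℝ) else 1) = 1 - 1 / (2 * L) := by
    have hindicator (a : Fin L) :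
        (if a = l then (1 / 2 : ℝ) else 1) = 1 - if a = l then 1 / 2 else 0 := by
      split_ifs <;> norm_num
    simp only [hindicator, Fintype.expect_eq_sum_div_card, sum_sub_distrib, sum_ite_eq', mem_univ,
      if_true, sum_const, card_univ, Fintype.card_fin, nsmul_eq_mul]
    field_simp
  calc 𝔼 w : Fin K → Fin L, (1 / 2 : ℝ) ^ #(holders w l)
      = 𝔼 w ∈ Fintype.piFinset fun _ : Fin K => (univ : Finset (Fin L)),
          ∏ k, if w k = l then (1 / 2 : ℝ) else 1 := by
        rw [Fintype.piFinset_univ]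
        refine expect_congr rfl fun w _ => ?_
        rw [← prod_filter, prod_const, holders]
    _ = (1 - 1 / (2 * L)) ^ K := by
        rw [expect_piFinset_prod (fun _ => univ_nonempty) univ
          fun _ a => if a = l then (1 / 2 : ℝ) else 1]
        simp only [hone, prod_const, card_univ, Fintype.card_fin]

lemma twoStageExpect_card_lt_le [NeZero L] (g : ℕ) (l : Fin L) :
    twoStageExpect (pulledHolders (K := K) g l) (fun A => if #A < g then 1 else 0)
      ≤ 2 ^ g * (1 - 1 / (2 * L)) ^ K := by
  rw [← expect_half_pow_card_holders l, mul_expect]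
  refine expect_le_expect fun w _ => expect_le (pulledHolders_nonempty g l w) fun A hA => ?_
  split_ifs with hAg
  · rw [one_div, inv_pow, ← div_eq_mul_inv, one_le_div (by positivity)]
    exact pow_le_pow_right₀ one_le_two (card_lt_of_mem_pullDown hA hAg).le
  · positivity

end SinglePacket

section SecondMoment

variable {K N F' L : ℕ}

/-- The number of packets in group `i` of file `n` that are stored by exactly the users in `W`. -/
def groupCount (S : Config K N (Packet F' L)) (n : Fin N) (W : Finset (Fin K)) (i : Fin F') : ℝ :=
  ∑ l : Fin L, if S n (i, l) = W then 1 else 0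

/-- The expectation of `groupCount` for a requested file, see `twoStageExpect_groupCount`. -/
noncomputable def groupMean (L g : ℕ) (W : Finset (Fin K)) : ℝ := ∑ l : Fin L, hitProb g l W

lemma groupMean_le [NeZero L] {g : ℕ} {W : Finset (Fin K)} (hW : #W = g) :
    groupMean L g W ≤ L / K.choose g := by
  refine (sum_le_sum fun l _ => hitProb_le l hW).trans_eq ?_
  simp [div_eq_mul_inv]

lemma storedCount_eq_sum_groupCount (S : Config K N (Packet F' L)) (n : Fin N)
    (W : Finset (Fin K)) : (storedCount S n W : ℝ) = ∑ i, groupCount S n W i := by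
  simp only [storedCount, groupCount, card_filter, Nat.cast_sum, Fintype.sum_prod_type,
    Nat.cast_ite, Nat.cast_one, Nat.cast_zero]

lemma groupCount_nonneg (S : Config K N (Packet F' L)) (n : Fin N) (W : Finset (Fin K))
    (i : Fin F') : 0 ≤ groupCount S n W i :=
  sum_nonneg fun _ _ => by split_ifs <;> norm_num

-- A user stores only one packet of the group.
lemma groupCount_le_one {g : ℕ} {d : Fin K → Fin N} {ω : Placement K N F' L}
    {S : Config K N (Packet F' L)} (hS : S ∈ virtualConfigs g d ω) (k : Fin K)
    {W : Finset (Fin K)} (hW : W.Nonempty) (i : Fin F') : groupCount S (d k) W i ≤ 1 := by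
  obtain ⟨u, hu⟩ := hW
  have hpos {l : Fin L} (hl : S (d k) (i, l) = W) : ω u (d k) i = l := by
    have hmem : u ∈ ω.config (d k) (i, l) :=
      subset_of_mem_pullDown (mem_pullDown_of_mem_pullDowns hS k (i, l)) (hl ▸ hu)
    exact (mem_filter.1 hmem).2
  rw [groupCount, sum_boole, Nat.cast_le_one]
  exact card_le_one.2 fun l hl l' hl' =>
    (hpos (mem_filter.1 hl).2).symm.trans (hpos (mem_filter.1 hl').2)

variable [NeZero L]

lemma twoStageExpect_groupCount (g : ℕ) (d : Fin K → Fin N) (k : Fin K) (W : Finset (Fin K))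
    (i : Fin F') :
    twoStageExpect (virtualConfigs g d) (fun S : Config K N (Packet F' L) =>
      groupCount S (d k) W i) = groupMean L g W := by
  simp only [groupCount, groupMean, twoStageExpect_sum]
  exact sum_congr rfl fun l _ =>
    twoStageExpect_virtualConfigs_apply g d k i l fun A => if A = W then 1 else 0

lemma twoStageExpect_groupCount_mul_groupCount (g : ℕ) (d : Fin K → Fin N) (k : Fin K)
    (W : Finset (Fin K)) {i i' : Fin F'} (hi : i ≠ i') :
    twoStageExpect (virtualConfigs g d) (fun S : Config K N (Packet F' L) =>
      groupCount S (d k) W i * groupCount S (d k) W i') = groupMean L g W * groupMean L g W := by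
  simp only [groupCount, groupMean, sum_mul_sum, twoStageExpect_sum]
  exact sum_congr rfl fun l _ => sum_congr rfl fun l' _ =>
    twoStageExpect_virtualConfigs_apply_mul_apply g d k hi l l' (fun A => if A = W then 1 else 0)
      fun A => if A = W then 1 else 0

lemma twoStageExpect_storedCount_sub_sq_le (g : ℕ) (d : Fin K → Fin N) (k : Fin K)
    {W : Finset (Fin K)} (hW : W.Nonempty) :
    twoStageExpect (virtualConfigs g d) (fun S : Config K N (Packet F' L) =>
      ((storedCount S (d k) W : ℝ) - F' * groupMean L g W) ^ 2) ≤ F' * groupMean L g W := by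
  simp only [storedCount_eq_sum_groupCount]
  simpa only [Fintype.card_fin] using twoStageExpect_sum_sub_sq_le (virtualConfigs_nonempty g d)
    (twoStageExpect_groupCount g d k W)
    (fun _ _ hij => twoStageExpect_groupCount_mul_groupCount g d k W hij)
    fun i => (twoStageExpect_mono fun _ S hS => mul_le_of_le_one_left
      (groupCount_nonneg S (d k) W i) (groupCount_le_one hS k hW i)).trans_eq
        (twoStageExpect_groupCount g d k W i)

lemma twoStageExpect_sup_storedCount_le {g : ℕ} (hg : 0 < g) (d : Fin K → Fin N)
    {U : Finset (Fin K)} (hU : #U = g + 1) :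
    twoStageExpect (virtualConfigs g d) (fun S : Config K N (Packet F' L) =>
        ((U.sup fun j => storedCount S (d j) (U.erase j) : ℕ) : ℝ))
      ≤ F' * L / K.choose g + √((g + 1) * (F' * L / K.choose g)) := by
  have hcard {j : Fin K} (hj : j ∈ U) : #(U.erase j) = g := by
    rw [card_erase_of_mem hj, hU, Nat.add_sub_cancel]
  have hmean {j : Fin K} (hj : j ∈ U) :
      F' * groupMean L g (U.erase j) ≤ F' * L / K.choose g := by
    rw [mul_div_assoc]
    gcongr
    exact groupMean_le (hcard hj)
  have hsup := twoStageExpect_sup_le (virtualConfigs_nonempty g d) (card_pos.1 (by omega))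
    (fun j (S : Config K N (Packet F' L)) => storedCount S (d j) (U.erase j)) (fun j => hmean)
    fun j hj => (twoStageExpect_storedCount_sub_sq_le g d j
      (card_pos.1 (hg.trans_eq (hcard hj).symm))).trans (hmean hj)
  simpa only [hU, Nat.cast_add_one] using hsup

end SecondMoment

section Rate

variable {K N F' L g : ℕ}

lemma length_packetList (F' L : ℕ) : (packetList F' L).length = F' * L := by
  simp only [packetList, List.length_product, List.length_finRange]

lemma mem_packetList (f : Packet F' L) : f ∈ packetList F' L :=
  List.mem_product.2 ⟨List.mem_finRange _, List.mem_finRange _⟩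

lemma expectedRate_nonneg (F' L g : ℕ) (d : Fin K → Fin N) : 0 ≤ expectedRate F' L g d :=
  expect_nonneg fun _ _ => expect_nonneg fun _ _ => by unfold rateND; positivity

lemma expectedRate_eq_div (F' L g : ℕ) (d : Fin K → Fin N) :
    expectedRate F' L g d = twoStageExpect (virtualConfigs g d) (fun S =>
      ((newDelivery (packetList F' L) S d).length : ℝ)) / (F' * L) := by
  simp only [expectedRate, expectedRateMD, twoStageExpect, virtualConfigs, rateND,
    length_packetList, Nat.cast_mul, expect_div]

lemma twoStageExpect_card_filter_card_lt_le [NeZero L] (g : ℕ) (d : Fin K → Fin N) (k : Fin K) :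
    twoStageExpect (virtualConfigs g d) (fun S : Config K N (Packet F' L) =>
      (#{f | #(S (d k) f) < g} : ℝ)) ≤ F' * L * (2 ^ g * (1 - 1 / (2 * L)) ^ K) := by
  have hpacket (f : Packet F' L) : twoStageExpect (virtualConfigs g d)
      (fun S : Config K N (Packet F' L) => if #(S (d k) f) < g then (1 : ℝ) else 0)
      ≤ 2 ^ g * (1 - 1 / (2 * L)) ^ K :=
    (twoStageExpect_virtualConfigs_apply g d k f.1 f.2
      fun A => if #A < g then 1 else 0).trans_le (twoStageExpect_card_lt_le g f.2)
  simp only [card_filter, Nat.cast_sum, Nat.cast_ite, Nat.cast_one, Nat.cast_zero,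
    twoStageExpect_sum]
  refine (sum_le_card_nsmul _ _ _ fun f _ => hpacket f).trans_eq ?_
  simp only [card_univ, Fintype.card_prod, Fintype.card_fin, nsmul_eq_mul, Nat.cast_mul]

lemma twoStageExpect_length_newDelivery_le [NeZero L] (hg : 0 < g) (d : Fin K → Fin N) :
    twoStageExpect (virtualConfigs g d) (fun S : Config K N (Packet F' L) =>
        ((newDelivery (packetList F' L) S d).length : ℝ))
      ≤ K.choose (g + 1) * (F' * L / K.choose g + √((g + 1) * (F' * L / K.choose g)))
        + K * (F' * L * (2 ^ g * (1 - 1 / (2 * L)) ^ K)) := by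
  calc twoStageExpect (virtualConfigs g d) (fun S : Config K N (Packet F' L) =>
        ((newDelivery (packetList F' L) S d).length : ℝ))
      ≤ twoStageExpect (virtualConfigs g d) fun S : Config K N (Packet F' L) =>
          (∑ U ∈ univ.powersetCard (g + 1),
            ((U.sup fun j => storedCount S (d j) (U.erase j) : ℕ) : ℝ))
          + ∑ j, (#{f | #(S (d j) f) < g} : ℝ) :=
        twoStageExpect_mono fun _ S hS => by
          have hlength := length_newDelivery_le mem_packetList (S := S) (d := d)
            fun k f => card_le_of_mem_pullDown (mem_pullDown_of_mem_pullDowns hS k f)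
          exact_mod_cast hlength
    _ ≤ #((univ : Finset (Fin K)).powersetCard (g + 1))
            • (F' * L / K.choose g + √((g + 1) * (F' * L / K.choose g)))
          + #(univ : Finset (Fin K)) • (F' * L * (2 ^ g * (1 - 1 / (2 * L)) ^ K)) := by
        rw [twoStageExpect_add, twoStageExpect_sum, twoStageExpect_sum]
        gcongr
        · exact sum_le_card_nsmul _ _ _ fun U hU =>
            twoStageExpect_sup_storedCount_le hg d (mem_powersetCard.1 hU).2
        · exact sum_le_card_nsmul _ _ _ fun j _ => twoStageExpect_card_filter_card_lt_le g d j
    _ = _ := by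
        simp only [card_powersetCard, card_univ, Fintype.card_fin, nsmul_eq_mul]

lemma cast_choose_succ_le (hgK : g ≤ K) :
    (K.choose (g + 1) : ℝ) ≤ K / (g + 1) * K.choose g := by
  rw [div_mul_eq_mul_div, le_div_iff₀ (by positivity), mul_comm (K : ℝ)]
  calc (K.choose (g + 1) * (g + 1) : ℝ) = K.choose g * (K - g) := by
        rw [← Nat.cast_sub hgK]
        exact_mod_cast Nat.choose_succ_right_eq K g
    _ ≤ K.choose g * K := by
        gcongr
        exact sub_le_self _ g.cast_nonneg

lemma expectedRate_le (hL : 0 < L) (hF : 0 < F') (hg : 0 < g) (hgK : g ≤ K)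
    (d : Fin K → Fin N) :
    expectedRate F' L g d ≤ K / (g + 1) * (1 + √((g + 1) * K.choose g / (F' * L)))
      + K * (2 ^ g * (1 - 1 / (2 * L)) ^ K) := by
  have : NeZero L := ⟨hL.ne'⟩
  have hFL : (0 : ℝ) < F' * L := by positivity
  have hB : (0 : ℝ) < K.choose g := Nat.cast_pos.2 (Nat.choose_pos hgK)
  have hsqrt : √((g + 1 : ℝ) * (F' * L / K.choose g))
      = F' * L / K.choose g * √((g + 1) * K.choose g / (F' * L)) := by
    rw [← Real.sqrt_sq (div_pos hFL hB).le, ← Real.sqrt_mul (sq_nonneg _),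
      Real.sqrt_sq (div_pos hFL hB).le]
    congr 1
    field_simp
  rw [expectedRate_eq_div, div_le_iff₀ hFL]
  refine (twoStageExpect_length_newDelivery_le hg d).trans ?_
  rw [hsqrt]
  calc _ ≤ K / (g + 1) * K.choose g * (F' * L / K.choose g
          + F' * L / K.choose g * √((g + 1) * K.choose g / (F' * L)))
        + K * (F' * L * (2 ^ g * (1 - 1 / (2 * L)) ^ K)) := by
        gcongr
        exact cast_choose_succ_le hgK
    _ = _ := by field_simp

end Rate

section Asymptotics

lemma two_pow_le_choose {n k : ℕ} (h : 2 * k < n) : 2 ^ k ≤ n.choose k := by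
  induction k generalizing n with
  | zero => simp
  | succ k ih =>
    obtain ⟨n, rfl⟩ := Nat.exists_eq_add_one_of_ne_zero h.ne_bot
    rw [Nat.choose_succ_succ', pow_succ, mul_two]
    have hmono := Nat.choose_le_succ_of_lt_half_left (r := k) (n := n) (by omega)
    exact add_le_add (ih (by omega)) ((ih (by omega)).trans hmono)

lemma le_choose {n k : ℕ} (hk : 0 < k) (h : 2 * k ≤ n) : n ≤ n.choose k := by
  induction k, hk using Nat.le_induction with
  | base => exact (n.choose_one_right).ge
  | succ k _ ih =>
    exact (ih (by omega)).trans (Nat.choose_le_succ_of_lt_half_left (by omega))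

lemma mul_two_pow_mul_pow_le {K L g : ℕ} (hL : 0 < L) (hg : (g : ℝ) ≤ K / (3 * L)) :
    ((g : ℝ) + 1) * (2 ^ g * (1 - 1 / (2 * L)) ^ K) ≤ 3 * Real.exp (-(K / L / 8)) := by
  have hL' : (1 : ℝ) ≤ L := Nat.one_le_cast.2 hL
  have hgx : (g : ℝ) ≤ K / L / 3 := by rwa [div_div, mul_comm (L : ℝ)]
  have hlin : (g : ℝ) + 1 ≤ 3 * Real.exp (K / L / 8) := by
    linarith [show (0 : ℝ) ≤ K / L by positivity, Real.add_one_le_exp (K / L / 8 : ℝ)]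
  have htwo : (2 : ℝ) ^ g ≤ Real.exp (K / L / 4) := by
    rw [← Real.exp_log (zero_lt_two (α := ℝ)), ← Real.exp_nat_mul]
    refine Real.exp_le_exp.2 ?_
    calc (g : ℝ) * Real.log 2 ≤ K / L / 3 * (3 / 4) := by
          gcongr
          linarith [Real.log_two_lt_d9]
      _ = K / L / 4 := by ring
  have hbase : (0 : ℝ) ≤ 1 - 1 / (2 * L) := by
    rw [sub_nonneg, div_le_one (by positivity)]
    linarith
  have hpow : (1 - 1 / (2 * L) : ℝ) ^ K ≤ Real.exp (-(K / L / 2)) := by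
    refine (pow_le_pow_left₀ hbase (Real.one_sub_le_exp_neg _) K).trans_eq ?_
    rw [← Real.exp_nat_mul]
    congr 1
    field_simp
  calc ((g : ℝ) + 1) * (2 ^ g * (1 - 1 / (2 * L)) ^ K)
      ≤ 3 * Real.exp (K / L / 8) * (Real.exp (K / L / 4) * Real.exp (-(K / L / 2))) := by gcongr
    _ = 3 * Real.exp (-(K / L / 8)) := by
        rw [mul_assoc, ← Real.exp_add, ← Real.exp_add]
        ring_nf

lemma add_one_le_three_mul_log_choose {K g : ℕ} (hg : 0 < g) (hgK : 2 * g < K) :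
    (g : ℝ) + 1 ≤ 3 * Real.log (K.choose g) := by
  have hg' : (1 : ℝ) ≤ g := Nat.one_le_cast.2 hg
  have hlog : g * Real.log 2 ≤ Real.log (K.choose g) := by
    rw [← Real.log_pow]
    exact Real.log_le_log (by positivity) (by exact_mod_cast two_pow_le_choose hgK)
  nlinarith [Real.log_two_gt_d9]

lemma mul_choose_div_le {c : ℝ} (hc : 0 < c) {K L F' g : ℕ} (hL : 0 < L) (hg : 0 < g)
    (hgK : 2 * g < K) (hF : c * (K.choose g * Real.log (K.choose g) ^ 2) ≤ F') :
    ((g : ℝ) + 1) * K.choose g / (F' * L) ≤ 3 / (c * Real.log K) := by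
  have hlogK : 0 < Real.log K := Real.log_pos (Nat.one_lt_cast.2 (by omega))
  have hlog : Real.log K ≤ Real.log (K.choose g) :=
    Real.log_le_log (Nat.cast_pos.2 (by omega)) (Nat.cast_le.2 (le_choose hg hgK.le))
  have hlogB : 0 < Real.log (K.choose g) := hlogK.trans_le hlog
  have hB : (0 : ℝ) < K.choose g := Nat.cast_pos.2 (Nat.choose_pos (by omega))
  calc ((g : ℝ) + 1) * K.choose g / (F' * L)
      ≤ 3 * Real.log (K.choose g) * K.choose g
          / (c * (K.choose g * Real.log (K.choose g) ^ 2) * 1) := by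
        gcongr
        · exact add_one_le_three_mul_log_choose hg hgK
        · exact Nat.one_le_cast.2 hL
    _ = 3 / (c * Real.log (K.choose g)) := by field_simp
    _ ≤ 3 / (c * Real.log K) := by gcongr

lemma exists_group_count {c : ℝ} (hc : 0 < c) {K g : ℕ} (hg : 0 < g) (hgK : 2 * g < K) (L : ℕ) :
    ∃ F' : ℕ, 0 < F' ∧ c * ((K.choose g : ℝ) * Real.log (K.choose g : ℝ) ^ 2) ≤ (F' : ℝ) ∧
      ((L * F' : ℕ) : ℝ)
        ≤ (c + 1) * ((K.choose g : ℝ) * Real.log (K.choose g : ℝ) ^ 2 * (L : ℝ)) := by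
  have hB : (3 : ℝ) ≤ K.choose g := by
    exact_mod_cast (show 3 ≤ K by omega).trans (le_choose hg hgK.le)
  have hlog : 1 ≤ Real.log (K.choose g) := by
    rw [Real.le_log_iff_exp_le (by linarith)]
    linarith [Real.exp_one_lt_three]
  have hone : 1 ≤ K.choose g * Real.log (K.choose g) ^ 2 :=
    one_le_mul_of_one_le_of_one_le (by linarith) (one_le_pow₀ hlog)
  generalize (K.choose g : ℝ) * Real.log (K.choose g) ^ 2 = A at hone ⊢
  refine ⟨⌈c * A⌉₊, Nat.ceil_pos.2 (by positivity), Nat.le_ceil _, ?_⟩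
  have hceil : (⌈c * A⌉₊ : ℝ) ≤ (c + 1) * A := by
    linarith [Nat.ceil_lt_add_one (show 0 ≤ c * A by positivity)]
  push_cast
  calc (L : ℝ) * ⌈c * A⌉₊ ≤ L * ((c + 1) * A) := by gcongr
    _ = (c + 1) * (A * L) := by ring

/-- The relative excess of the expected rate over `K / (g + 1)`: the first term bounds the
fluctuations of the counts of stored packets, the second the packets stored by fewer than `g`
users. -/
noncomputable def rateExcess (a c : ℝ) (K : ℕ) : ℝ :=
  √(3 / (c * Real.log K)) + 3 * (K : ℝ) ^ (-(a / 8))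

lemma tendsto_rateExcess {a c : ℝ} (ha : 0 < a) (hc : 0 < c) :
    Filter.Tendsto (rateExcess a c) Filter.atTop (nhds 0) := by
  have hlog : Filter.Tendsto (fun K : ℕ => c * Real.log K) Filter.atTop Filter.atTop :=
    (Real.tendsto_log_atTop.comp tendsto_natCast_atTop_atTop).const_mul_atTop hc
  have hsqrt : Filter.Tendsto (fun K : ℕ => √(3 / (c * Real.log K))) Filter.atTop (nhds 0) := by
    simpa only [Real.sqrt_zero] using (hlog.const_div_atTop 3).sqrt
  have hpow : Filter.Tendsto (fun K : ℕ => (K : ℝ) ^ (-(a / 8))) Filter.atTop (nhds 0) :=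
    (tendsto_rpow_neg_atTop (by positivity)).comp tendsto_natCast_atTop_atTop
  unfold rateExcess
  simpa only [mul_zero, add_zero] using hsqrt.add (hpow.const_mul 3)

lemma expectedRate_le_mul_one_add_rateExcess {a c : ℝ} (ha : 0 < a) (hc : 0 < c)
    {K N F' L g : ℕ} (hL : 0 < L) (hg : 0 < g) (hgK : 2 * g < K) (hgL : (g : ℝ) ≤ K / (3 * L))
    (hLK : (L : ℝ) ≤ K / (a * Real.log K))
    (hF : c * (K.choose g * Real.log (K.choose g) ^ 2) ≤ F') (d : Fin K → Fin N) :
    expectedRate F' L g d ≤ K / (g + 1) * (1 + rateExcess a c K) := by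
  have hK : (1 : ℝ) < K := Nat.one_lt_cast.2 (by omega)
  have hlogK : 0 < Real.log K := Real.log_pos hK
  have hF0 : 0 < F' := by
    have hB : (1 : ℝ) < K.choose g := Nat.one_lt_cast.2 (by linarith [le_choose hg hgK.le])
    have := Real.log_pos hB
    exact Nat.cast_pos.1 ((show 0 < c * (K.choose g * Real.log (K.choose g) ^ 2) by
      positivity).trans_le hF)
  have hexp : Real.exp (-(K / L / 8)) ≤ (K : ℝ) ^ (-(a / 8)) := by
    rw [Real.rpow_def_of_pos (by positivity), Real.exp_le_exp]
    have : a * Real.log K ≤ K / L := by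
      rwa [le_div_comm₀ (by positivity) (by positivity)]
    linarith
  have hsqrt : √((g + 1) * K.choose g / (F' * L)) ≤ √(3 / (c * Real.log K)) :=
    Real.sqrt_le_sqrt (mul_choose_div_le hc hL hg hgK hF)
  have htail : (g + 1) * (2 ^ g * (1 - 1 / (2 * L)) ^ K) ≤ 3 * (K : ℝ) ^ (-(a / 8)) :=
    (mul_two_pow_mul_pow_le hL hgL).trans (mul_le_mul_of_nonneg_left hexp zero_le_three)
  calc expectedRate F' L g d
      ≤ K / (g + 1) * (1 + √((g + 1) * K.choose g / (F' * L)))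
          + K * (2 ^ g * (1 - 1 / (2 * L)) ^ K) := expectedRate_le hL hF0 hg (by omega) d
    _ = K / (g + 1) * (1 + (√((g + 1) * K.choose g / (F' * L))
          + (g + 1) * (2 ^ g * (1 - 1 / (2 * L)) ^ K))) := by field_simp; ring
    _ ≤ K / (g + 1) * (1 + (√(3 / (c * Real.log K)) + 3 * (K : ℝ) ^ (-(a / 8)))) := by
        gcongr ?_ * (1 + ?_)
        exact add_le_add hsqrt htail
    _ = K / (g + 1) * (1 + rateExcess a c K) := rfl

end Asymptotics

end CodedCaching

theorem theorem7_general (a c : ℝ) (ha : 0 < a) (hc : 0 < c) :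
    ∃ ε : ℕ → ℝ, Filter.Tendsto ε Filter.atTop (nhds 0) ∧
      ∀ K N g L : ℕ, 0 < L → 0 < g → (g : ℝ) ≤ (K : ℝ) / (3 * (L : ℝ)) →
        (L : ℝ) ≤ (K : ℝ) / (a * Real.log (K : ℝ)) →
        (∀ F' : ℕ,
          c * ((K.choose g : ℝ) * Real.log (K.choose g : ℝ) ^ 2) ≤ (F' : ℝ) →
          ∀ d : Fin K → Fin N,
            CodedCaching.expectedRate F' L g d ≤ (K : ℝ) / ((g : ℝ) + 1) * (1 + ε K)) ∧
        ∃ F' : ℕ, 0 < F' ∧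
          c * ((K.choose g : ℝ) * Real.log (K.choose g : ℝ) ^ 2) ≤ (F' : ℝ) ∧
          ((L * F' : ℕ) : ℝ)
            ≤ (c + 1) * ((K.choose g : ℝ) * Real.log (K.choose g : ℝ) ^ 2 * (L : ℝ)) := by
  refine ⟨CodedCaching.rateExcess a c, CodedCaching.tendsto_rateExcess ha hc,
    fun K N g L hL hg hgL hLK => ?_⟩
  have hgK : 2 * g < K := by
    have hmul : g * (3 * L) ≤ K := by
      exact_mod_cast (le_div_iff₀ (by positivity)).1 hgL
    nlinarith
  exact ⟨fun F' hF d =>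
    CodedCaching.expectedRate_le_mul_one_add_rateExcess ha hc hL hg hgK hgL hLK hF d,
    CodedCaching.exists_group_count hc hg hgK L⟩

theorem theorem7 (c : ℝ) (hc : 0 < c) :
    ∃ ε : ℕ → ℝ, Filter.Tendsto ε Filter.atTop (nhds 0) ∧
      ∀ (K N g : ℕ) (M : ℝ), 0 < M → K < N → 2 ≤ g →
        (g : ℝ) ≤ (K : ℝ) / (3 * (CodedCaching.groupSize N M : ℝ)) →
        (CodedCaching.groupSize N M : ℝ) ≤ (K : ℝ) / (27 / 4 * Real.log (K : ℝ)) →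
        (∀ F' : ℕ,
          c * ((K.choose g : ℝ) * Real.log (K.choose g : ℝ) ^ 2) ≤ (F' : ℝ) →
          ∀ d : Fin K → Fin N,
            CodedCaching.expectedRate F' (CodedCaching.groupSize N M) g d
              ≤ 4 / 3 * ((K : ℝ) / ((g : ℝ) + 1)) * (1 + ε K)) ∧
        ∃ F' : ℕ, 0 < F' ∧
          c * ((K.choose g : ℝ) * Real.log (K.choose g : ℝ) ^ 2) ≤ (F' : ℝ) ∧
          ((CodedCaching.groupSize N M * F' : ℕ) : ℝ)
            ≤ (c + 1) * ((K.choose g : ℝ) * Real.log (K.choose g : ℝ) ^ 2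
                * (CodedCaching.groupSize N M : ℝ)) := by
  obtain ⟨ε, hε, hmain⟩ := theorem7_general (27 / 4) c (by norm_num) hc
  refine ⟨ε, hε, fun K N g M hM hKN hg hgL hLK => ?_⟩
  have hN : (0 : ℝ) < N := Nat.cast_pos.2 (Nat.zero_lt_of_lt hKN)
  have hL : 0 < CodedCaching.groupSize N M := Nat.ceil_pos.2 (div_pos hN hM)
  obtain ⟨hrate, hF⟩ := hmain K N g _ hL (by omega) hgL hLK
  refine ⟨fun F' hF' d => ?_, hF⟩
  linarith [hrate F' hF' d, CodedCaching.expectedRate_nonneg F' (CodedCaching.groupSize N M) g d]
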